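/- Work in one-sorted first-order logic with equality and one binary symbol $\in$; the objects are called classes. Put $\mathrm{set}(x)\iff\exists k\,(x\in k)$, and let $V$ be the class of all sets. Ordered pairs are Kuratowski pairs $\langle a,b\rangle=\{\{a\},\{a,b\}\}$ of sets, and a function is a class $f$ of ordered pairs in which the first component determines the second. For a function $f$ and a class $x$, say that $f$ *permutes* $x$ if $f$ maps $x$ bijectively onto $x$. Write $f``x=\{f(y):y\in x\}$ and $j f=\{\langle x,f``x\rangle : x\in V,\ f``x\in V\}$. Say that - $f$ $0$-permutes $x$ if $f$ permutes $V$; - $f$ $1$-permutes $x$ if $f$ $0$-permutes $x$ and $f$ permutes $x$; - $f$ $2$-permutes (ultrapermutes) $x$ if $f$ $1$-permutes $x$ and $jf$ permutes $x$. Put $y\in^f x\iff f(y)\in x$, and for a formula $\Phi$ let $\Phi^f$ be the formula obtained by replacing every $\in$ in $\Phi$ by $\in^f$. Let $T$ be the theory with the following axioms. 1. **Extensionality**: $\forall z\,(z\in X\leftrightarrow z\in Y)\to X=Y$. 2. **Class Comprehension**: $\exists x\,\forall y\,(y\in x\leftrightarrow \mathrm{set}(y)\wedge\varphi)$, for every formula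 $\varphi$ (class parameters and class quantifiers allowed) in which $x$ is not free. 3. **Pairing**: $\forall a\,\forall b\,\forall x\,\bigl[\forall y\in x\,(y=a\vee y=b)\to\mathrm{set}(x)\bigr]$. 4. **Invariant Comprehension**: for $i\in\{0,1\}$, $j\in\{0,2\}$ and every formula $\varphi$ with all quantifiers bounded by $V$ and free variables among $y,w,v$, writing $\Phi$ for $\forall y\,(y\in x\leftrightarrow y\in V\wedge\varphi)$, $$\forall w,v\in V\ \forall x\ \Bigl[\Phi\wedge\forall f\bigl(f\ i\text{-permutes } w \text{ and } v,\ \text{and } f\ j\text{-permutes } x\ \to\ (\Phi\leftrightarrow\Phi^f)\bigr)\ \to\ x\in V\Bigr].$$ Then $T$ proves (here, by the completeness theorem, "proves" may be read as "every model of $T$ satisfies") the following five sentences: - *Sheffer stroke*: for all $a,b\in V$, $\{y\in V:\neg(y\in a\wedge y\in b)\}\in V$; - *Singletons*: for all $a\in V$, $\{a\}\in V$; - *Set union*: for all $a\in V$, $\bigcup a\in V$; - *Unordered relative products*: for all $r,s\in V$, $\{\{a,c\}:\exists b\,(\{a,b\}\in r\wedge\{b,c\}\in s)\}\in V$; - *Unordered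 intersection relation*: $\{\{x,y\}:x,y\in V,\ \exists z\,(z\in x\wedge z\in y)\}\in V$. Moreover $T$ interprets Quine's $\mathrm{NF}$ (extensionality together with comprehension $\exists x\,\forall y\,(y\in x\leftrightarrow\varphi)$ for all stratified $\varphi$ in which $x$ is not free, with parameters) on the sets: $T$ proves $\exists x\,\mathrm{set}(x)$, and for every sentence $\sigma$ provable in $\mathrm{NF}$, $T$ proves the sentence $\sigma^V$ obtained from $\sigma$ by restricting all quantifiers to $V$. -/

import Mathlib

open FirstOrder

namespace InvClass

/-! ### The first-order language of membership -/

/-- The only non-logical symbol: the binary membership symbol. -/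
inductive MemRel : ℕ → Type
  | mem : MemRel 2

/-- The one-sorted first-order language (with equality) whose only symbol is membership. -/
def L : FirstOrder.Language.{0, 0} := ⟨fun _ => Empty, MemRel⟩

/-- Formulas whose free variables are among `0, …, n - 1`. A quantifier in front of a formula with
free variables among `0, …, n` binds the variable `n`. -/
abbrev Fml (n : ℕ) := L.BoundedFormula Empty n

/-- Every term of `L` is a variable; this is the variable. -/
def idx {n : ℕ} : L.Term (Empty ⊕ Fin n) → Fin n
  | .var (.inr i) => i
  | .var (.inl e) => e.elim
  | .func f _ => Empty.elim f

/-- The formula `i ∈ j`. -/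
def mem {n : ℕ} (i j : Fin n) : Fml n :=
  .rel MemRel.mem ![.var (.inr i), .var (.inr j)]

/-- The formula `i = j`. -/
def eq {n : ℕ} (i j : Fin n) : Fml n :=
  .equal (.var (.inr i)) (.var (.inr j))

/-- `i↟` is the variable `i`, seen below one further quantifier. -/
local postfix:max "↟" => Fin.castSucc

/-! ### Sets, pairs, functions, permutations -/

/-- `x` is a set: `∃ k, x ∈ k`. -/
def isSet {n : ℕ} (x : Fin n) : Fml n :=
  ∃' mem x↟ (Fin.last _)

/-- `v` is the class `V` of all sets. -/
def isUniv {n : ℕ} (v : Fin n) : Fml n :=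
  ∀' (mem (Fin.last _) v↟ ⇔ isSet (Fin.last _))

/-- `a`, `b` are sets and `p = {a, b}`. -/
def isUPair {n : ℕ} (p a b : Fin n) : Fml n :=
  isSet a ⊓ isSet b ⊓
    ∀' (mem (Fin.last _) p↟ ⇔ (eq (Fin.last _) a↟ ⊔ eq (Fin.last _) b↟))

/-- `a`, `b` are sets and `p` is the Kuratowski pair `⟨a, b⟩ = {{a}, {a, b}}`. -/
def isOPair {n : ℕ} (p a b : Fin n) : Fml n :=
  ∃' (isUPair (Fin.last _) a↟ a↟ ⊓
    ∃' (isUPair (Fin.last _) a↟↟ b↟↟ ⊓ isUPair p↟↟ (Fin.last _)↟ (Fin.last _)))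

/-- `⟨a, b⟩ ∈ f`. -/
def app {n : ℕ} (f a b : Fin n) : Fml n :=
  ∃' (isOPair (Fin.last _) a↟ b↟ ⊓ mem (Fin.last _) f↟)

/-- `f` is a function: a class of ordered pairs in which the first projection determines the
second. -/
def isFun {n : ℕ} (f : Fin n) : Fml n :=
  (∀' (mem (Fin.last _) f↟ ⟹
    ∃' ∃' isOPair (Fin.last _)↟↟ (Fin.last _)↟ (Fin.last _))) ⊓
  (∀' ∀' ∀' ((app f↟↟↟ (Fin.last _)↟↟ (Fin.last _)↟ ⊓ app f↟↟↟ (Fin.last _)↟↟ (Fin.last _)) ⟹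
    eq (Fin.last _)↟ (Fin.last _)))

/-- `f` permutes `x`: the function `f` maps `x` bijectively onto `x`. The clauses are: `f` is a
function, it sends every element of `x` into `x`, it is injective on `x`, and every element
of `x` is the value of an element of `x`. -/
def permutes {n : ℕ} (f x : Fin n) : Fml n :=
  isFun f ⊓
  (∀' (mem (Fin.last _) x↟ ⟹
    ∃' (mem (Fin.last _) x↟↟ ⊓ app f↟↟ (Fin.last _)↟ (Fin.last _)))) ⊓
  (∀' ∀' ∀' ((mem (Fin.last _)↟↟ x↟↟↟ ⊓ mem (Fin.last _)↟ x↟↟↟ ⊓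
      app f↟↟↟ (Fin.last _)↟↟ (Fin.last _) ⊓ app f↟↟↟ (Fin.last _)↟ (Fin.last _)) ⟹
    eq (Fin.last _)↟↟ (Fin.last _)↟)) ⊓
  (∀' (mem (Fin.last _) x↟ ⟹
    ∃' (mem (Fin.last _) x↟↟ ⊓ app f↟↟ (Fin.last _) (Fin.last _)↟)))

/-- `b` is the image `f``a = {f(y) : y ∈ a}`. -/
def isImage {n : ℕ} (b f a : Fin n) : Fml n :=
  ∀' (mem (Fin.last _) b↟ ⇔
    ∃' (mem (Fin.last _) a↟↟ ⊓ app f↟↟ (Fin.last _) (Fin.last _)↟))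

/-- `g` is the class `j f` of all ordered pairs `⟨a, f``a⟩` with `a ∈ V`. (An ordered pair has sets
as its components, so `j f` is defined at those `a` for which `f``a` is a set.) -/
def isJ {n : ℕ} (g f : Fin n) : Fml n :=
  ∀' (mem (Fin.last _) g↟ ⇔
    ∃' ∃' (isOPair (Fin.last _)↟↟ (Fin.last _)↟ (Fin.last _) ⊓
      isImage (Fin.last _) f↟↟↟ (Fin.last _)↟))

/-- `f` `0`-permutes (anything): `f` is a permutation of `V`. -/
def permutes0 {n : ℕ} (f : Fin n) : Fml n :=
  ∃' (isUniv (Fin.last _) ⊓ permutes f↟ (Fin.last _))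

/-- `f` `1`-permutes `x`. -/
def permutes1 {n : ℕ} (f x : Fin n) : Fml n :=
  permutes0 f ⊓ permutes f x

/-- `f` `2`-permutes (ultrapermutes) `x`. -/
def permutes2 {n : ℕ} (f x : Fin n) : Fml n :=
  permutes1 f x ⊓ ∃' (isJ (Fin.last _) f↟ ⊓ permutes (Fin.last _) x↟)

/-- `f` `k`-permutes `x`, for `k = 0, 1, 2`. -/
def kPermutes {n : ℕ} (k : Fin 3) (f x : Fin n) : Fml n :=
  match k with
  | 0 => permutes0 f
  | 1 => permutes1 f x
  | 2 => permutes2 f x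

/-! ### Operations on formulas -/

/-- `f`-membership `y ∈^f x`, that is, `f(y) ∈ x`. -/
def fmem {n : ℕ} (f y x : Fin n) : Fml n :=
  ∃' (app f↟ y↟ (Fin.last _) ⊓ mem (Fin.last _) x↟)

/-- `φ^f`: every occurrence of `∈` in `φ` is replaced by `∈^f`, where `f` is a variable. -/
def twist : {n : ℕ} → (f : Fin n) → Fml n → Fml n
  | _, _, .falsum => .falsum
  | _, _, .equal s t => .equal s t
  | _, f, .rel MemRel.mem ts => fmem f (idx (ts 0)) (idx (ts 1))
  | _, f, .imp φ ψ => .imp (twist f φ) (twist f ψ)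
  | _, f, .all φ => .all (twist f↟ φ)

/-- All quantifiers of the formula are bounded by `V`. -/
def relV : {n : ℕ} → Fml n → Fml n
  | _, .falsum => .falsum
  | _, .equal s t => .equal s t
  | _, .rel R ts => .rel R ts
  | _, .imp φ ψ => .imp (relV φ) (relV ψ)
  | _, .all φ => .all (isSet (Fin.last _) ⟹ relV φ)

/-! ### The class theory -/

/-- Extensionality. -/
def extensionality : L.Sentence :=
  ∀' ∀' (∀' (mem 2 0 ⇔ mem 2 1) ⟹ (eq 0 1 : Fml 2))

/-- Class comprehension for `φ(p₀, …, pₙ₋₁, y)`: for all classes `p₀, …, pₙ₋₁` there is a class `x`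
whose elements are the sets `y` with `φ`. (`φ.liftAt 1 n` is `φ` with the variable `y` renamed
from `n` to `n + 1`, to make room for `x`.) -/
def classComprehension {n : ℕ} (φ : Fml (n + 1)) : L.Sentence :=
  (∃' ∀' (mem (Fin.last _) (Fin.last _)↟ ⇔ (isSet (Fin.last _) ⊓ φ.liftAt 1 n))).alls

/-- Pairing: every class all of whose elements are among `a`, `b` is a set. Here `a`, `b`, `x`, `y`
are the variables `0, 1, 2, 3`. -/
def pairing : L.Sentence :=
  ∀' ∀' ∀' (∀' (mem 3 2 ⟹ (eq 3 0 ⊔ eq 3 1)) ⟹ (isSet 2 : Fml 3))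

/-- The formula `∀ y, (y ∈ x ↔ y ∈ V ∧ φ(w, v, y))`, all quantifiers of `φ` being bounded by `V`.
The free variables `w`, `v`, `y` of `φ` are `0, 1, 2`; in the result `w`, `v`, `x` are `0, 1, 2`
and `y` is the bound variable `3`. -/
def defines (φ : Fml 3) : Fml 3 :=
  ∀' (mem 3 2 ⇔ (isSet 3 ⊓ (relV φ).liftAt 1 2))

/-- The invariant comprehension axiom for `φ(w, v, y)` and `i`, `j`: for all sets `w`, `v` and
every class `x`, if `Φ` and `∀ f, (f i-permutes w and v, and f j-permutes x → (Φ ↔ Φ^f))`, where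
`Φ` is `defines φ`, then `x` is a set. The variables `w`, `v`, `x`, `f` are `0, 1, 2, 3`. -/
def invariantComprehension (i j : Fin 3) (φ : Fml 3) : L.Sentence :=
  ∀' ∀' ((isSet 0 ⊓ isSet 1) ⟹ ∀'
    ((defines φ ⊓
      ∀' ((kPermutes i 3 0 ⊓ kPermutes i 3 1 ⊓ kPermutes j 3 2) ⟹
        ((defines φ).liftAt 1 3 ⇔ twist 3 ((defines φ).liftAt 1 3)))) ⟹
      (isSet 2 : Fml 3)))

/-- The axioms of the class theory: extensionality, class comprehension, pairing, and invariant comprehension for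
`i ∈ {0, 1}` and `j ∈ {0, 2}`. -/
inductive IsClassAxiom : L.Sentence → Prop
  | ext : IsClassAxiom extensionality
  | comp {n : ℕ} (φ : Fml (n + 1)) : IsClassAxiom (classComprehension φ)
  | pair : IsClassAxiom pairing
  | inv (i j : Fin 3) (hi : i = 0 ∨ i = 1) (hj : j = 0 ∨ j = 2) (φ : Fml 3) :
      IsClassAxiom (invariantComprehension i j φ)

/-- The class theory. -/
def classTheory : L.Theory := {σ | IsClassAxiom σ}

/-! ### The five axioms, in the language of classes -/

/-- For all sets `a`, `b`, the class `a ↑ b = {y ∈ V : ¬ (y ∈ a ∧ y ∈ b)}` is a set. -/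
def shefferStroke : L.Sentence :=
  ∀' ∀' ((isSet 0 ⊓ isSet 1) ⟹ ∃' (isSet 2 ⊓
    ∀' (mem 3 2 ⇔ (isSet 3 ⊓ ∼(mem 3 0 ⊓ (mem 3 1 : Fml 4))))))

/-- For every set `a`, the class `{a}` is a set. -/
def singletons : L.Sentence :=
  ∀' (isSet 0 ⟹ ∃' (isSet 1 ⊓ ∀' (mem 2 1 ⇔ (isSet 2 ⊓ (eq 2 0 : Fml 3)))))

/-- For every set `a`, the class `⋃ a` is a set. -/
def setUnion : L.Sentence :=
  ∀' (isSet 0 ⟹ ∃' (isSet 1 ⊓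
    ∀' (mem 2 1 ⇔ (isSet 2 ⊓ ∃' (isSet 3 ⊓ mem 3 0 ⊓ (mem 2 3 : Fml 4))))))

/-- For all sets `r`, `s`, the class `{{a, c} : ∃ b, {a, b} ∈ r ∧ {b, c} ∈ s}` is a set.
The variables `r`, `s`, `x`, `y`, `a`, `b`, `c` are `0, …, 6`. -/
def unorderedRelativeProducts : L.Sentence :=
  ∀' ∀' ((isSet 0 ⊓ isSet 1) ⟹ ∃' (isSet 2 ⊓
    ∀' (mem 3 2 ⇔ (isSet 3 ⊓ ∃' ∃' ∃' (isUPair 3 4 6 ⊓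
      ∃' (isUPair 7 4 5 ⊓ mem 7 0) ⊓ ∃' (isUPair 7 5 6 ⊓ (mem 7 1 : Fml 8)))))))

/-- The class `{{x, y} : ∃ z, z ∈ x ∧ z ∈ y}` is a set. -/
def unorderedIntersection : L.Sentence :=
  ∃' (isSet 0 ⊓ ∀' (mem 1 0 ⇔ (isSet 1 ⊓ ∃' ∃' (isUPair 1 2 3 ⊓
    ∃' (isSet 4 ⊓ mem 4 2 ⊓ (mem 4 3 : Fml 5))))))

/-! ### NF -/

/-- The indexing `s` of the free variables of the formula by naturals extends to its bound variables
in such a way that `x = y` forces equal indices and `x ∈ y` forces the index of `y` to be one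
more than that of `x`. -/
def StratifiedBy : {n : ℕ} → (s : Fin n → ℕ) → Fml n → Prop
  | _, _, .falsum => True
  | _, s, .equal t u => s (idx t) = s (idx u)
  | _, s, .rel MemRel.mem ts => s (idx (ts 1)) = s (idx (ts 0)) + 1
  | _, s, .imp φ ψ => StratifiedBy s φ ∧ StratifiedBy s ψ
  | _, s, .all φ => ∃ k : ℕ, StratifiedBy (Fin.snoc s k : Fin (_ + 1) → ℕ) φ

/-- Stratified formulas. -/
def Stratified {n : ℕ} (φ : Fml n) : Prop :=
  ∃ s : Fin n → ℕ, StratifiedBy s φ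

/-- Set comprehension for `φ(p₀, …, pₙ₋₁, y)`: for all `p₀, …, pₙ₋₁` there is `x` whose elements are
exactly the `y` with `φ`. -/
def setComprehension {n : ℕ} (φ : Fml (n + 1)) : L.Sentence :=
  (∃' ∀' (mem (Fin.last _) (Fin.last _)↟ ⇔ φ.liftAt 1 n)).alls

/-- The axioms of Quine's New Foundations: extensionality and stratified comprehension. -/
inductive IsNFAxiom : L.Sentence → Prop
  | ext : IsNFAxiom extensionality
  | comp {n : ℕ} (φ : Fml (n + 1)) (hφ : Stratified φ) : IsNFAxiom (setComprehension φ)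

/-- Quine's New Foundations. -/
def NF : L.Theory := {σ | IsNFAxiom σ}

/-- `T` interprets `S` on the sets: the domain of the interpretation is `V`, equality and membership
are interpreted by themselves, `T` proves that the domain is not empty, and the translation of
every theorem of `S` is a theorem of `T`. -/
def InterpretsOnSets (T S : L.Theory) : Prop :=
  T ⊨ᵇ (∃' (isSet 0 : Fml 1) : L.Sentence) ∧ ∀ σ : L.Sentence, S ⊨ᵇ σ → T ⊨ᵇ (relV σ : L.Sentence)

end InvClass

/-! Let `F` be the permutation of the sets given by a class `f` that permutes `V`. Suppose the
variables of a formula carry types 0, 1, 2, type 2 being reserved for parameters that `F` maps onto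
themselves. Then the twisted formula holds exactly when the original one holds with `F` applied to
the values of type 0 (`sat_twist_of_typed`). So Invariant Comprehension yields `{y : φ}` when `y`
has type 0, because `F` permutes this collection, and when `y` has type 1, because then nothing
moves. A collection of pairs `{a, b}` with `a`, `b` of type 1 is turned by the twist into its image
under `jF`; this is where ultrapermutation enters. Apart from Singletons, which is a case of
Pairing, the five sentences are such instances. Only the axiom with `i = 1`, `j = 2` is needed: it
tests the fewest `f`, so it implies the others.

Further instances of the same kind give NF, by coding assignments as sets. Taking singletons
repeatedly raises the values of all variables to a common type `D`, and one complement of a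
singleton, at depth `i`, marks the value of variable `i` (`entry`). An assignment is coded by the
finite set of its entries, and a stratified formula is represented by a set containing exactly those
codes whose assignments satisfy it (`exists_represents`). Equality is read off from the set of
singletons, and membership from the intersection relation, since `a ∈ b` iff `{a}` meets `b`.
Stratification makes the numbers of letters on the two sides of an atom agree, so these relations
can be lifted to entries one letter at a time. A quantifier amounts to adding one element to a code.
-/

namespace InvClass

open FirstOrder.Language

/-! ### Satisfaction in a set with a binary relation -/

/-- The structure whose membership relation is `R`. -/
abbrev str {M : Type*} (R : M → M → Prop) : L.Structure M where
  funMap := fun f => Empty.elim f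
  RelMap := fun r => match r with
    | MemRel.mem => fun xs => R (xs 0) (xs 1)

/-- Satisfaction of a formula when membership is interpreted as `R`. -/
def Sat {M : Type*} (R : M → M → Prop) {n : ℕ} (φ : Fml n) (xs : Fin n → M) : Prop :=
  @BoundedFormula.Realize L M (str R) Empty n φ default xs

section Sat

variable {M : Type*} {R : M → M → Prop} {n : ℕ} {φ ψ : Fml n} {xs : Fin n → M}

theorem realize_idx (t : L.Term (Empty ⊕ Fin n)) (v : Empty → M) :
    @Term.realize L M (str R) _ (Sum.elim v xs) t = xs (idx t) := by
  rcases t with (i | i) | f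
  · exact i.elim
  · rfl
  · exact Empty.elim f

theorem sat_rel (ts : Fin 2 → L.Term (Empty ⊕ Fin n)) :
    Sat R (.rel MemRel.mem ts) xs ↔ R (xs (idx (ts 0))) (xs (idx (ts 1))) :=
  Iff.of_eq (congrArg₂ R (realize_idx (ts 0) default) (realize_idx (ts 1) default))

theorem sat_equal (t u : L.Term (Empty ⊕ Fin n)) :
    Sat R (.equal t u) xs ↔ xs (idx t) = xs (idx u) :=
  Iff.of_eq (congrArg₂ Eq (realize_idx (R := R) t default) (realize_idx (R := R) u default))

@[simp] theorem sat_mem (i j : Fin n) : Sat R (mem i j) xs ↔ R (xs i) (xs j) := sat_rel _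

@[simp] theorem sat_eq (i j : Fin n) : Sat R (eq i j) xs ↔ xs i = xs j := sat_equal _ _

@[simp] theorem sat_imp : Sat R (φ.imp ψ) xs ↔ (Sat R φ xs → Sat R ψ xs) := Iff.rfl

@[simp] theorem sat_all {φ : Fml (n + 1)} :
    Sat R φ.all xs ↔ ∀ a, Sat R φ (Fin.snoc xs a : Fin (n + 1) → M) := Iff.rfl

@[simp] theorem sat_ex {φ : Fml (n + 1)} :
    Sat R φ.ex xs ↔ ∃ a, Sat R φ (Fin.snoc xs a : Fin (n + 1) → M) :=
  @BoundedFormula.realize_ex L M (str R) _ _ _ _ _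

@[simp] theorem sat_inf : Sat R (φ ⊓ ψ) xs ↔ Sat R φ xs ∧ Sat R ψ xs :=
  @BoundedFormula.realize_inf L M (str R) _ _ _ _ _ _

@[simp] theorem sat_sup : Sat R (φ ⊔ ψ) xs ↔ Sat R φ xs ∨ Sat R ψ xs :=
  @BoundedFormula.realize_sup L M (str R) _ _ _ _ _ _

@[simp] theorem sat_iff : Sat R (φ ⇔ ψ) xs ↔ (Sat R φ xs ↔ Sat R ψ xs) :=
  @BoundedFormula.realize_iff L M (str R) _ _ _ _ _ _

@[simp] theorem sat_not : Sat R (∼φ) xs ↔ ¬ Sat R φ xs := Iff.rfl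

theorem sat_liftAt_one {m : ℕ} (hm : m ≤ n) (xs : Fin (n + 1) → M) :
    Sat R (φ.liftAt 1 m) xs ↔
      Sat R φ (xs ∘ fun i => if (i : ℕ) < m then i.castSucc else i.succ) :=
  @BoundedFormula.realize_liftAt_one L M (str R) _ _ _ _ _ _ hm

theorem sat_alls (xs₀ : Fin 0 → M) : Sat R φ.alls xs₀ ↔ ∀ xs, Sat R φ xs := by
  let _ := str R
  have := BoundedFormula.realize_alls (φ := φ) (v := (default : Empty → M))
  rw [Formula.Realize] at this
  rw [← Subsingleton.elim default xs₀]
  exact this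

@[simp] theorem sat_isSet (i : Fin n) : Sat R (isSet i) xs ↔ ∃ k, R (xs i) k := by
  simp [isSet]

theorem sat_isUPair (p a b : Fin n) : Sat R (isUPair p a b) xs ↔
    (∃ k, R (xs a) k) ∧ (∃ k, R (xs b) k) ∧ ∀ z, R z (xs p) ↔ z = xs a ∨ z = xs b := by
  simp [isUPair, and_assoc]

/-- The elements of the class `p` are the sets `a` and `b`. -/
def UPair (R : M → M → Prop) (p a b : M) : Prop :=
  (∃ k, R a k) ∧ (∃ k, R b k) ∧ ∀ z, R z p ↔ z = a ∨ z = b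

/-- `p` is the Kuratowski pair of `a` and `b`. -/
def OPair (R : M → M → Prop) (p a b : M) : Prop :=
  ∃ c, UPair R c a a ∧ ∃ d, UPair R d a b ∧ UPair R p c d

/-- The class `f` sends `a` to `b`. -/
def App (R : M → M → Prop) (f a b : M) : Prop := ∃ p, OPair R p a b ∧ R p f

theorem sat_isOPair (p a b : Fin n) : Sat R (isOPair p a b) xs ↔
    OPair R (xs p) (xs a) (xs b) := by
  simp [isOPair, OPair, UPair, sat_isUPair]

theorem sat_app (f a b : Fin n) : Sat R (app f a b) xs ↔ App R (xs f) (xs a) (xs b) := by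
  simp [app, App, sat_isOPair]

/-- `y ∈^f x`: the class `f` sends `y` to an element of `x`. -/
def twistRel (R : M → M → Prop) (f y x : M) : Prop := ∃ z, App R f y z ∧ R z x

theorem sat_twist (f : Fin n) :
    Sat R (twist f φ) xs ↔ Sat (twistRel R (xs f)) φ xs := by
  induction φ with
  | falsum => rfl
  | equal t u => rw [sat_equal]; exact sat_equal t u
  | rel r ts =>
    cases r
    refine Iff.trans ?_ (sat_rel ts).symm
    simp [twist, fmem, sat_app, twistRel]
  | imp φ ψ ihφ ihψ => simp [twist, ihφ, ihψ]
  | all φ ih => simp [twist, ih]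

/-- The predicate `p` is kept separate from `∃ k, R x k` because the lemma is also applied to the
twisted relation: its sets are the same objects, but not by definition. -/
theorem sat_relV {p : M → Prop} (hp : ∀ x, p x ↔ ∃ k, R x k) (xs : Fin n → Subtype p) :
    Sat R (relV φ) (fun i => (xs i : M)) ↔ Sat (fun a b : Subtype p => R a b) φ xs := by
  induction φ with
  | falsum => rfl
  | equal t u => rw [sat_equal, Subtype.ext_iff]; exact sat_equal t u
  | rel r ts =>
    cases r
    exact (sat_rel ts).trans (sat_rel (R := fun a b : Subtype p => R a b) ts).symm
  | imp φ ψ ihφ ihψ => simp [relV, ihφ, ihψ]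
  | all φ ih =>
    have key : ∀ a : Subtype p, (Fin.snoc (fun i => (xs i : M)) (a : M) : Fin _ → M) =
        fun i => ((Fin.snoc xs a : Fin _ → Subtype p) i : M) := by
      intro a
      funext i
      refine Fin.lastCases ?_ (fun j => ?_) i <;> simp
    simp only [relV, sat_all, sat_imp, sat_isSet, Fin.snoc_last, ← hp]
    rw [Subtype.forall]
    refine forall₂_congr fun a ha => ?_
    rw [← ih, ← key ⟨a, ha⟩]

end Sat

/-! ### The sets of a model of the class theory -/

section Perm

variable {M : Type*} {R : M → M → Prop} {n : ℕ} {xs : Fin n → M}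

/-- `f` is a class of ordered pairs in which the first component determines the second. -/
def IsFun (R : M → M → Prop) (f : M) : Prop :=
  (∀ p, R p f → ∃ a b, OPair R p a b) ∧ ∀ a b c, App R f a b → App R f a c → b = c

/-- `f` is a function mapping `x` bijectively onto `x`. -/
def Permutes (R : M → M → Prop) (f x : M) : Prop :=
  IsFun R f ∧ (∀ a, R a x → ∃ b, R b x ∧ App R f a b) ∧
    (∀ a b c, R a x → R b x → App R f a c → App R f b c → a = b) ∧
    ∀ b, R b x → ∃ a, R a x ∧ App R f a b

theorem sat_permutes (f x : Fin n) : Sat R (permutes f x) xs ↔ Permutes R (xs f) (xs x) := by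
  simp [permutes, isFun, Permutes, IsFun, sat_isOPair, sat_app, and_assoc]

/-- The class `g` is `j f`. -/
def IsJ (R : M → M → Prop) (g f : M) : Prop :=
  ∀ p, R p g ↔ ∃ a b, OPair R p a b ∧ ∀ z, R z b ↔ ∃ u, R u a ∧ App R f u z

theorem sat_isJ (g f : Fin n) : Sat R (isJ g f) xs ↔ IsJ R (xs g) (xs f) := by
  simp [isJ, isImage, IsJ, sat_isOPair, sat_app]

theorem sat_permutes0 (f : Fin n) : Sat R (permutes0 f) xs ↔
    ∃ V, (∀ y, R y V ↔ ∃ k, R y k) ∧ Permutes R (xs f) V := by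
  simp [permutes0, isUniv, sat_permutes]

theorem sat_permutes1 (f x : Fin n) : Sat R (permutes1 f x) xs ↔
    (∃ V, (∀ y, R y V ↔ ∃ k, R y k) ∧ Permutes R (xs f) V) ∧ Permutes R (xs f) (xs x) := by
  simp [permutes1, sat_permutes0, sat_permutes]

theorem sat_permutes2 (f x : Fin n) : Sat R (permutes2 f x) xs ↔
    ((∃ V, (∀ y, R y V ↔ ∃ k, R y k) ∧ Permutes R (xs f) V) ∧ Permutes R (xs f) (xs x)) ∧
      ∃ g, IsJ R g (xs f) ∧ Permutes R g (xs x) := by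
  simp [permutes2, sat_permutes1, sat_permutes, sat_isJ]

theorem OPair.isSet_left {p a b : M} (h : OPair R p a b) : ∃ k, R a k := by
  obtain ⟨c, hc, -⟩ := h
  exact hc.1

theorem OPair.inj {p a b a' b' : M} (h : OPair R p a b) (h' : OPair R p a' b') :
    a = a' ∧ b = b' := by
  obtain ⟨c, ⟨-, -, hc⟩, d, ⟨-, -, hd⟩, -, -, hp⟩ := h
  obtain ⟨c', ⟨-, -, hc'⟩, d', ⟨-, -, hd'⟩, -, -, hp'⟩ := h'
  have h1 : c = c' ∨ c = d' := by rw [← hp', hp]; exact Or.inl rfl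
  have h2 : d = c' ∨ d = d' := by rw [← hp', hp]; exact Or.inr rfl
  have h3 : c' = c ∨ c' = d := by rw [← hp, hp']; exact Or.inl rfl
  have h4 : d' = c ∨ d' = d := by rw [← hp, hp']; exact Or.inr rfl
  have e1 : a = a' := by
    rcases h1 with rfl | rfl
    · simpa using (hc' a).1 ((hc a).2 (Or.inl rfl))
    · have := (hc a').1 ((hd' a').2 (Or.inl rfl))
      simpa using (this.elim id id).symm
  subst e1
  refine ⟨rfl, ?_⟩
  have hcc : ∀ x, R x c' ↔ R x c := fun x => by rw [hc, hc']
  have hdd : ∀ x, R x d ↔ R x d' := by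
    intro x
    rcases h2 with rfl | rfl
    · rcases h4 with rfl | rfl
      · exact hcc x
      · rfl
    · rfl
  have k1 := (hd' b).1 ((hdd b).1 ((hd b).2 (Or.inr rfl)))
  have k2 := (hd b').1 ((hdd b').2 ((hd' b').2 (Or.inr rfl)))
  grind

end Perm

/-- A nonempty extensional membership relation with unordered pairs, in which every definable
collection invariant under suitable permutations is a set. -/
structure InvModel {N : Type*} (e : N → N → Prop) : Prop where
  nonempty : Nonempty N
  ext : ∀ a b, (∀ z, e z a ↔ e z b) → a = b
  pair : ∀ a b, ∃ p, ∀ z, e z p ↔ z = a ∨ z = b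
  inv : ∀ (φ : Fml 3) (w v : N),
    (∀ F : Equiv.Perm N, (∀ y, e (F y) w ↔ e y w) → (∀ y, e (F y) v ↔ e y v) →
      (∀ y, Sat e φ ![w, v, F y] ↔ Sat e φ ![w, v, y]) →
      (∀ y, Sat e φ ![w, v, y] → ∃ z, Sat e φ ![w, v, z] ∧ ∀ u, e (F u) z ↔ e u y) →
      (∀ z, Sat e φ ![w, v, z] → ∃ y, Sat e φ ![w, v, y] ∧ ∀ u, e (F u) z ↔ e u y) →
      ∀ y, Sat e φ ![w, v, y] ↔ Sat (fun a b => e (F a) b) φ ![w, v, y]) →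
    ∃ x, ∀ y, e y x ↔ Sat e φ ![w, v, y]

/-! ### From the class axioms to properties of the sets -/

section Model

variable {M : Type*} {R : M → M → Prop}

/-- Membership between sets. -/
def setRel (R : M → M → Prop) (a b : {x // ∃ k, R x k}) : Prop := R a b

theorem sat_extensionality :
    Sat R extensionality default ↔ ∀ X Y, (∀ z, R z X ↔ R z Y) → X = Y := by
  simp [extensionality, Fin.snoc]

theorem sat_liftAt_snoc_snoc {n : ℕ} (φ : Fml (n + 1)) (xs : Fin n → M) (x y : M) :
    Sat R (φ.liftAt 1 n) (Fin.snoc (Fin.snoc xs x : Fin (n + 1) → M) y : Fin (n + 2) → M) ↔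
      Sat R φ (Fin.snoc xs y) := by
  rw [sat_liftAt_one (Nat.le_succ n)]
  refine Eq.to_iff (congrArg _ ?_)
  funext i
  refine Fin.lastCases ?_ (fun j => ?_) i
  · simp only [Function.comp_apply, Fin.val_last, lt_irrefl, if_false, Fin.succ_last,
      Fin.snoc_last]
  · simp

theorem sat_classComprehension {n : ℕ} (φ : Fml (n + 1)) :
    Sat R (classComprehension φ) default ↔
      ∀ xs : Fin n → M, ∃ x, ∀ y, R y x ↔ (∃ k, R y k) ∧ Sat R φ (Fin.snoc xs y) := by
  rw [classComprehension, sat_alls]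
  simp [sat_liftAt_snoc_snoc]

theorem sat_setComprehension {n : ℕ} (φ : Fml (n + 1)) :
    Sat R (setComprehension φ) default ↔
      ∀ xs : Fin n → M, ∃ x, ∀ y, R y x ↔ Sat R φ (Fin.snoc xs y) := by
  rw [setComprehension, sat_alls]
  simp [sat_liftAt_snoc_snoc]

theorem sat_pairing :
    Sat R pairing default ↔
      ∀ a b x, (∀ y, R y x → y = a ∨ y = b) → ∃ k, R x k := by
  simp [pairing, Fin.snoc]

theorem sat_defines (φ : Fml 3) (w v x : M) :
    Sat R (defines φ) ![w, v, x] ↔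
      ∀ y, R y x ↔ (∃ k, R y k) ∧ Sat R (relV φ) ![w, v, y] := by
  have key : ∀ y : M, ((Fin.snoc ![w, v, x] y : Fin 4 → M) ∘
      fun i : Fin 3 => if (i : ℕ) < 2 then i.castSucc else i.succ) = ![w, v, y] := by
    intro y
    funext i
    fin_cases i <;> rfl
  simp only [defines, sat_all, sat_iff, sat_inf, sat_mem, sat_isSet,
    sat_liftAt_one (show 2 ≤ 3 by decide), key]
  rfl

theorem sat_invariantComprehension (φ : Fml 3) :
    Sat R (invariantComprehension 1 2 φ) default ↔
      ∀ w v, ((∃ k, R w k) ∧ ∃ k, R v k) → ∀ x,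
        (Sat R (defines φ) ![w, v, x] ∧ ∀ f,
          (Sat R (permutes1 0 1 : Fml 2) ![f, w] ∧ Sat R (permutes1 0 1 : Fml 2) ![f, v] ∧
            Sat R (permutes2 0 1 : Fml 2) ![f, x]) →
          (Sat R (defines φ) ![w, v, x] ↔ Sat (twistRel R f) (defines φ) ![w, v, x])) →
        ∃ k, R x k := by
  have key : ∀ w v x f : M,
      ((Fin.snoc (Fin.snoc (Fin.snoc (Fin.snoc (default : Fin 0 → M) w : Fin 1 → M) v :
        Fin 2 → M) x : Fin 3 → M) f : Fin 4 → M) ∘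
      fun i : Fin 3 => if (i : ℕ) < 3 then i.castSucc else i.succ) = ![w, v, x] := by
    intro w v x f
    funext i
    fin_cases i <;> rfl
  have key' : ∀ w v x : M, (Fin.snoc (Fin.snoc (Fin.snoc (default : Fin 0 → M) w : Fin 1 → M) v :
        Fin 2 → M) x : Fin 3 → M) = ![w, v, x] := by
    intro w v x
    funext i
    fin_cases i <;> rfl
  simp only [invariantComprehension, kPermutes, sat_all, sat_imp, sat_inf, sat_isSet, sat_iff,
    sat_twist, sat_liftAt_one (le_refl 3), key, sat_permutes1, sat_permutes2]
  simp only [key', and_assoc]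
  rfl

theorem exists_perm {f : M} (V : M) (hV : ∀ y, R y V ↔ ∃ k, R y k) (hf : Permutes R f V) :
    ∃ F : Equiv.Perm {x // ∃ k, R x k}, ∀ a b, App R f a b ↔ ∃ h, ((F ⟨a, h⟩ : _) : M) = b := by
  obtain ⟨⟨-, hfun⟩, htot, hinj, hsurj⟩ := hf
  have h1 : ∀ a : {x // ∃ k, R x k}, ∃ b : {x // ∃ k, R x k}, App R f a b := by
    intro a
    obtain ⟨b, hb, hab⟩ := htot a ((hV _).2 a.2)
    exact ⟨⟨b, (hV _).1 hb⟩, hab⟩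
  choose F hF using h1
  have hbij : Function.Bijective F := by
    constructor
    · intro a b hab
      exact Subtype.ext (hinj a b (F a) ((hV _).2 a.2) ((hV _).2 b.2) (hF a) (hab ▸ hF b))
    · intro b
      obtain ⟨a, ha, hab⟩ := hsurj b ((hV _).2 b.2)
      exact ⟨⟨a, (hV _).1 ha⟩, Subtype.ext (hfun a _ _ (hF ⟨a, _⟩) hab)⟩
  refine ⟨Equiv.ofBijective F hbij, fun a b => ⟨fun h => ?_, ?_⟩⟩
  · obtain ⟨p, hp, -⟩ := id h
    exact ⟨hp.isSet_left, hfun a _ _ (hF ⟨a, _⟩) h⟩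
  · rintro ⟨h, rfl⟩
    exact hF ⟨a, h⟩

theorem invModel_of_sat (h : ∀ σ, IsClassAxiom σ → Sat R σ default) [Nonempty M] :
    InvModel (setRel R) := by
  have ext := sat_extensionality.1 (h _ .ext)
  have comp : ∀ {n : ℕ} (φ : Fml (n + 1)) (xs : Fin n → M), ∃ x, ∀ y, R y x ↔
      (∃ k, R y k) ∧ Sat R φ (Fin.snoc xs y) := fun φ => (sat_classComprehension φ).1 (h _ (.comp φ))
  have pair := sat_pairing.1 (h _ .pair)
  have hvec : ∀ (S : M → M → Prop) (φ : Fml 3) (w v y : M), Sat S φ (Fin.snoc ![w, v] y) ↔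
      Sat S φ ![w, v, y] := by
    intro S φ w v y
    have : (Fin.snoc ![w, v] y : Fin 3 → M) = ![w, v, y] := by
      funext i
      fin_cases i <;> rfl
    rw [this]
  refine ⟨?_, ?_, ?_, ?_⟩
  · obtain ⟨x, hx⟩ := comp (.falsum : Fml 1) ![]
    obtain ⟨a⟩ := ‹Nonempty M›
    exact ⟨⟨x, pair a a x fun y hy => (((hx y).1 hy).2).elim⟩⟩
  · intro a b hab
    refine Subtype.ext (ext _ _ fun z => ⟨fun hz => ?_, fun hz => ?_⟩)
    · exact (hab ⟨z, _, hz⟩).1 hz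
    · exact (hab ⟨z, _, hz⟩).2 hz
  · intro a b
    obtain ⟨x, hx⟩ := comp (eq 2 0 ⊔ eq 2 1 : Fml 3) ![(a : M), b]
    simp only [hvec, sat_sup, sat_eq] at hx
    refine ⟨⟨x, pair a b x fun y hy => ((hx y).1 hy).2⟩, fun z => ?_⟩
    rw [Subtype.ext_iff, Subtype.ext_iff]
    exact (hx z).trans (and_iff_right z.2)
  · intro φ w v hF
    obtain ⟨x, hx⟩ := comp (relV φ) ![(w : M), v]
    simp only [hvec] at hx
    have hvec' : ∀ y : {x // ∃ k, R x k}, (![(w : M), v, y] : Fin 3 → M) =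
        fun i => ((![w, v, y] : Fin 3 → _) i : M) := by
      intro y
      funext i
      fin_cases i <;> rfl
    have hrel : ∀ y : {x // ∃ k, R x k}, Sat R (relV φ) ![(w : M), v, y] ↔
        Sat (setRel R) φ ![w, v, y] := by
      intro y
      rw [hvec']
      exact sat_relV (fun _ => Iff.rfl) _
    have hx' : ∀ y : {x // ∃ k, R x k}, R y x ↔ Sat (setRel R) φ ![w, v, y] := fun y => by
      rw [hx, hrel, and_iff_right y.2]
    have hdef := (sat_defines (R := R) φ (w : M) (v : M) x).2 hx
    have hset : ∃ k, R x k := by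
      -- `Φ` holds because `x` was obtained by class comprehension, so invariance reduces to proving
      -- `Φ^f`.
      refine (sat_invariantComprehension φ).1 (h _ (.inv 1 2 (Or.inr rfl) (Or.inr rfl) φ)) w v
        ⟨w.2, v.2⟩ x ⟨hdef, fun f hf => iff_of_true hdef ?_⟩
      rw [sat_permutes1, sat_permutes1, sat_permutes2] at hf
      obtain ⟨⟨⟨V, hV, hfV⟩, hfw⟩, ⟨-, hfv⟩, ⟨-, hfx⟩, g, hg, hgx⟩ := hf
      simp only [Matrix.cons_val_zero, Matrix.cons_val_one] at hfV hfw hfv hfx hg hgx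
      obtain ⟨F, hFapp⟩ := exists_perm V hV hfV
      have htw : ∀ (y : {x // ∃ k, R x k}) (b : M), twistRel R f y b ↔ R (F y) b := by
        intro y b
        simp only [twistRel, hFapp]
        constructor
        · rintro ⟨z, ⟨_, rfl⟩, hz⟩
          exact hz
        · intro hb
          exact ⟨_, ⟨y.2, rfl⟩, hb⟩
      have htw' : ∀ {y b : M}, twistRel R f y b → ∃ k, R y k := by
        rintro y b ⟨z, ⟨p, hp, -⟩, -⟩
        exact hp.isSet_left
      have hperm : ∀ b, Permutes R f b → ∀ y, R (F y) b ↔ R y b := by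
        rintro b ⟨-, h1, -, h3⟩ y
        constructor
        · intro hy
          obtain ⟨a, ha, hab⟩ := h3 _ hy
          obtain ⟨h0, h0'⟩ := (hFapp _ _).1 hab
          have := F.injective (Subtype.ext h0')
          rw [← this]
          exact ha
        · intro hy
          obtain ⟨a, ha, hab⟩ := h1 _ hy
          obtain ⟨h0, h0'⟩ := (hFapp _ _).1 hab
          rw [← h0'] at ha
          exact ha
      have hJ : ∀ a b, App R g a b → ∀ u : {x // ∃ k, R x k}, R (F u) b ↔ R u a := by
        rintro a b ⟨p, hp, hpg⟩ u
        obtain ⟨a', b', hp', hb'⟩ := (hg p).1 hpg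
        obtain ⟨rfl, rfl⟩ := hp.inj hp'
        rw [hb']
        constructor
        · rintro ⟨u', hu', hu⟩
          obtain ⟨h0, h0'⟩ := (hFapp _ _).1 hu
          rw [← F.injective (Subtype.ext h0')]
          exact hu'
        · intro hu
          exact ⟨u, hu, (hFapp _ _).2 ⟨u.2, rfl⟩⟩
      have main := hF F (hperm _ hfw) (hperm _ hfv)
        (fun y => by rw [← hx', ← hx']; exact hperm _ hfx y)
        (fun y hy => by
          obtain ⟨z, hz, hyz⟩ := hgx.2.1 y ((hx' y).2 hy)
          exact ⟨⟨z, _, hz⟩, (hx' ⟨z, _, hz⟩).1 hz, hJ _ _ hyz⟩)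
        (fun z hz => by
          obtain ⟨y, hy, hyz⟩ := hgx.2.2.2 z ((hx' z).2 hz)
          exact ⟨⟨y, _, hy⟩, (hx' ⟨y, _, hy⟩).1 hy, hJ _ _ hyz⟩)
      rw [sat_defines]
      intro y
      by_cases hy : ∃ k, R y k
      · lift y to {x // ∃ k, R x k} using hy
        have hrelF : Sat (twistRel R f) (relV φ) ![(w : M), v, y] ↔
            Sat (fun a b => setRel R (F a) b) φ ![w, v, y] := by
          rw [hvec', sat_relV (p := fun x => ∃ k, R x k)]
          · simp only [htw]
            rfl
          · intro x
            constructor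
            · rintro hx
              obtain ⟨k, hk⟩ := (F ⟨x, hx⟩).2
              exact ⟨k, (htw ⟨x, hx⟩ k).2 hk⟩
            · rintro ⟨k, hk⟩
              exact htw' hk
        rw [hrelF, ← main, ← hx', htw, hperm _ hfx]
        refine ⟨fun hy => ⟨?_, hy⟩, fun hy => hy.2⟩
        exact ⟨x, (htw _ _).2 ((hperm _ hfx y).2 hy)⟩
      · exact iff_of_false (fun hy' => hy (htw' hy')) fun hy' => hy (htw' hy'.1.choose_spec)
    exact ⟨⟨x, hset⟩, hx'⟩

end Model

/-! ### Formulas with two types of bound variables -/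

/-- The variables of the formula have the types given by `s`, where bound variables have types `0`
and `1`, and only variables of type at most `2` occur in membership statements. -/
def typed : {n : ℕ} → (s : Fin n → ℕ) → Fml n → Bool
  | _, _, .falsum => true
  | _, s, .equal t u => s (idx t) == s (idx u)
  | _, s, .rel MemRel.mem ts =>
      s (idx (ts 1)) == s (idx (ts 0)) + 1 && Nat.ble (s (idx (ts 1))) 2
  | _, s, .imp φ ψ => typed s φ && typed s ψ
  | _, s, .all φ =>
      typed (Fin.snoc s 0 : Fin (_ + 1) → ℕ) φ || typed (Fin.snoc s 1 : Fin (_ + 1) → ℕ) φ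

/-- In an atom `a ∈ b` of types 0 and 1, the twist puts `F` on `a`, which is the shift claimed. In
types 1 and 2, the `F` on `a` is absorbed by the invariance of `b`. -/
theorem sat_twist_of_typed {N : Type*} {e : N → N → Prop} (F : Equiv.Perm N) {n : ℕ} (φ : Fml n)
    (s : Fin n → ℕ) (h : typed s φ = true) (xs : Fin n → N)
    (hxs : ∀ i, s i = 2 → ∀ y, e (F y) (xs i) ↔ e y (xs i)) :
    Sat (fun a b => e (F a) b) φ xs ↔ Sat e φ fun i => if s i = 0 then F (xs i) else xs i := by
  induction φ with
  | falsum => rfl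
  | equal t u =>
    have h' : s (idx t) = s (idx u) := by simpa [typed] using h
    rw [sat_equal, sat_equal, h']
    split <;> simp
  | rel r ts =>
    cases r
    have h' : s (idx (ts 1)) = s (idx (ts 0)) + 1 ∧ s (idx (ts 1)) ≤ 2 := by
      simpa [typed] using h
    refine (sat_rel ts).trans (Iff.trans ?_ (sat_rel ts).symm)
    by_cases h0 : s (idx (ts 0)) = 0
    · rw [if_pos h0, if_neg (by omega)]
    · rw [if_neg h0, if_neg (by omega)]
      exact hxs _ (by omega) _
  | imp φ ψ ihφ ihψ =>
    have h' : typed s φ = true ∧ typed s ψ = true := by simpa [typed] using h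
    rw [sat_imp, sat_imp, ihφ s h'.1 xs hxs, ihψ s h'.2 xs hxs]
  | all φ ih =>
    have h' : typed (Fin.snoc s 0 : Fin (_ + 1) → ℕ) φ = true ∨
        typed (Fin.snoc s 1 : Fin (_ + 1) → ℕ) φ = true := by simpa [typed] using h
    have hsnoc : ∀ k : ℕ, k ≠ 2 → ∀ (a : N) i, (Fin.snoc s k : Fin (_ + 1) → ℕ) i = 2 →
        ∀ y, e (F y) ((Fin.snoc xs a : Fin (_ + 1) → N) i) ↔
          e y ((Fin.snoc xs a : Fin (_ + 1) → N) i) := by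
      intro k hk a i
      refine Fin.lastCases ?_ (fun j => ?_) i
      · intro h2
        simp only [Fin.snoc_last] at h2
        exact absurd h2 hk
      · simpa only [Fin.snoc_castSucc] using hxs j
    have hval : ∀ (k : ℕ) (a : N), (fun i => if (Fin.snoc s k : Fin (_ + 1) → ℕ) i = 0
        then F ((Fin.snoc xs a : Fin (_ + 1) → N) i) else (Fin.snoc xs a : Fin (_ + 1) → N) i) =
        (Fin.snoc (fun i => if s i = 0 then F (xs i) else xs i) (if k = 0 then F a else a) :
          Fin (_ + 1) → N) := by
      intro k a
      funext i
      refine Fin.lastCases ?_ (fun j => ?_) i <;> simp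
    rw [sat_all, sat_all]
    rcases h' with h' | h'
    -- A bound variable of type 0 is shifted by `F`; surjectivity of `F` removes the shift from the
    -- quantifier.
    · refine Iff.trans (forall_congr' fun a => ?_) F.surjective.forall.symm
      rw [ih _ h' _ (hsnoc 0 (by decide) a), hval, if_pos rfl]
    · refine forall_congr' fun a => ?_
      rw [ih _ h' _ (hsnoc 1 (by decide) a), hval, if_neg one_ne_zero]

/-- `p = {a, b}`. -/
def upair {n : ℕ} (p a b : Fin n) : Fml n :=
  ∀' (mem (Fin.last _) p.castSucc ⇔ (eq (Fin.last _) a.castSucc ⊔ eq (Fin.last _) b.castSucc))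

section

variable {N : Type*} {e : N → N → Prop} {n : ℕ} {xs : Fin n → N}

@[simp] theorem sat_upair (p a b : Fin n) :
    Sat e (upair p a b) xs ↔ ∀ z, e z (xs p) ↔ z = xs a ∨ z = xs b := by
  simp [upair]

end

/-! ### Comprehension for typed formulas and for pairs -/

namespace InvModel

variable {N : Type*} {e : N → N → Prop} (he : InvModel e)

include he

/-- Twisting replaces `y` by `F y`, and `F` permutes the defined collection. The types `s + 1`, `t +
1` keep the parameters from being shifted. -/
theorem comp_zero (φ : Fml 3) (w v : N) (s t : ℕ) (h : typed ![s + 1, t + 1, 0] φ = true) :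
    ∃ x, ∀ y, e y x ↔ Sat e φ ![w, v, y] := by
  refine he.inv φ w v fun F hw hv hP _ _ y => ?_
  rw [sat_twist_of_typed F φ _ h]
  · rw [← hP]
    refine Eq.to_iff (congrArg _ ?_)
    funext i
    fin_cases i <;> simp
  · intro i
    fin_cases i
    · exact fun _ => hw
    · exact fun _ => hv
    · exact fun h => absurd h (by simp)

/-- No free variable has type 0, so the formula agrees with its twist without any condition on how
`F` acts on the collection. -/
theorem comp_one (φ : Fml 3) (w v : N) (s t : ℕ) (h : typed ![s + 1, t + 1, 1] φ = true) :
    ∃ x, ∀ y, e y x ↔ Sat e φ ![w, v, y] := by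
  refine he.inv φ w v fun F hw hv _ _ _ y => ?_
  rw [sat_twist_of_typed F φ _ h]
  · refine Eq.to_iff (congrArg _ ?_)
    funext i
    fin_cases i <;> simp
  · intro i
    fin_cases i
    · exact fun _ => hw
    · exact fun _ => hv
    · exact fun h => absurd h (by simp)

/-- The condition `ψ` on `a`, `b` of type 1 is unchanged by the twist, while `y = {a, b}` becomes `y
= F``{a, b}`. The twisted collection is thus the image of the original under `jF`, and `jF` permutes
the original. -/
theorem comp_pair (ψ : Fml 4) (w v : N) (s t : ℕ) (h : typed ![s + 1, t + 1, 1, 1] ψ = true) :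
    ∃ x, ∀ y, e y x ↔ ∃ a b, (∀ z, e z y ↔ z = a ∨ z = b) ∧ Sat e ψ ![w, v, a, b] := by
  have key : ∀ (S : N → N → Prop) (y : N),
      Sat S (∃' ∃' (upair 2 3 4 ⊓ ψ.liftAt 1 2) : Fml 3) ![w, v, y] ↔
        ∃ a b, (∀ z, S z y ↔ z = a ∨ z = b) ∧ Sat S ψ ![w, v, a, b] := by
    intro S y
    simp only [sat_ex, sat_inf, sat_upair, sat_liftAt_one (show 2 ≤ 4 by decide)]
    refine exists_congr fun a => exists_congr fun b => and_congr Iff.rfl ?_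
    refine Eq.to_iff (congrArg _ ?_)
    funext i
    fin_cases i <;> rfl
  have main := he.inv (∃' ∃' (upair 2 3 4 ⊓ ψ.liftAt 1 2)) w v
  simp only [key] at main
  refine main fun F hw hv _ h1 h2 y => ?_
  have hψ : ∀ a b, Sat (fun a b => e (F a) b) ψ ![w, v, a, b] ↔ Sat e ψ ![w, v, a, b] := by
    intro a b
    rw [sat_twist_of_typed F ψ _ h]
    · refine Eq.to_iff (congrArg _ ?_)
      funext i
      fin_cases i <;> simp
    · intro i
      fin_cases i
      · exact fun _ => hw
      · exact fun _ => hv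
      · exact fun h => absurd h (by simp)
      · exact fun h => absurd h (by simp)
  simp only [hψ]
  constructor
  · intro hy
    obtain ⟨p, ⟨a, b, hp, hab⟩, hpy⟩ := h2 y hy
    exact ⟨a, b, fun z => by rw [hpy, hp], hab⟩
  · rintro ⟨a, b, hy, hab⟩
    obtain ⟨p, hp⟩ := he.pair a b
    obtain ⟨z, hz, hpz⟩ := h1 p ⟨a, b, hp, hab⟩
    have : z = y := he.ext _ _ fun u => by
      obtain ⟨u, rfl⟩ := F.surjective u
      rw [hpz, hp, hy]
    exact this ▸ hz

end InvModel

/-! ### Closure properties of the sets -/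

/-- `q` is the singleton of `a`, or its complement if `c` is true. -/
def IsLetter {N : Type*} (e : N → N → Prop) (c : Bool) (q a : N) : Prop :=
  ∀ z, e z q ↔ bif c then ¬ z = a else z = a

/-- The formula expressing `IsLetter`. -/
def letterFml {n : ℕ} (c : Bool) (q a : Fin n) : Fml n :=
  match c with
  | false => ∀' (mem (Fin.last _) q.castSucc ⇔ eq (Fin.last _) a.castSucc)
  | true => ∀' (mem (Fin.last _) q.castSucc ⇔ ∼(eq (Fin.last _) a.castSucc))

@[simp] theorem sat_letterFml {N : Type*} {e : N → N → Prop} {n : ℕ} {xs : Fin n → N} (c : Bool)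
    (q a : Fin n) : Sat e (letterFml c q a) xs ↔ IsLetter e c (xs q) (xs a) := by
  cases c <;> simp [letterFml, IsLetter]

namespace InvModel

variable {N : Type*} {e : N → N → Prop} (he : InvModel e)

include he

theorem exists_sheffer (a b : N) : ∃ x, ∀ y, e y x ↔ ¬ (e y a ∧ e y b) := by
  simpa [Fin.snoc] using he.comp_zero (∼(mem 2 0 ⊓ mem 2 1)) a b 0 0 (by decide)

theorem exists_compl (a : N) : ∃ x, ∀ y, e y x ↔ ¬ e y a := by
  simpa using he.exists_sheffer a a

theorem exists_inter (a b : N) : ∃ x, ∀ y, e y x ↔ e y a ∧ e y b := by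
  obtain ⟨x, hx⟩ := he.exists_sheffer a b
  obtain ⟨z, hz⟩ := he.exists_compl x
  exact ⟨z, fun y => by rw [hz, hx, not_not]⟩

theorem exists_union (a b : N) : ∃ x, ∀ y, e y x ↔ e y a ∨ e y b := by
  obtain ⟨a', ha⟩ := he.exists_compl a
  obtain ⟨b', hb⟩ := he.exists_compl b
  obtain ⟨x, hx⟩ := he.exists_sheffer a' b'
  exact ⟨x, fun y => by rw [hx, ha, hb]; tauto⟩

theorem exists_univ : ∃ x, ∀ y, e y x := by
  obtain ⟨a⟩ := he.nonempty
  obtain ⟨b, hb⟩ := he.exists_compl a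
  obtain ⟨x, hx⟩ := he.exists_union a b
  exact ⟨x, fun y => by rw [hx, hb]; exact em _⟩

theorem exists_empty : ∃ x, ∀ y, ¬ e y x := by
  obtain ⟨a, ha⟩ := he.exists_univ
  obtain ⟨b, hb⟩ := he.exists_compl a
  exact ⟨b, fun y => by rw [hb, not_not]; exact ha y⟩

theorem exists_sUnion (a : N) : ∃ x, ∀ y, e y x ↔ ∃ z, e z a ∧ e y z := by
  simpa [Fin.snoc] using he.comp_zero (∃' (mem 3 0 ⊓ mem 2 3)) a a 1 1 (by decide)

theorem exists_singletons : ∃ x, ∀ y, e y x ↔ ∃ u, ∀ z, e z y ↔ z = u := by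
  obtain ⟨a⟩ := he.nonempty
  simpa [Fin.snoc] using he.comp_one (∃' (upair 2 3 3)) a a 0 0 (by decide)

theorem exists_letter_image (c : Bool) (a : N) :
    ∃ x, ∀ y, e y x ↔ ∃ u, e u a ∧ IsLetter e c y u := by
  simpa [Fin.snoc] using he.comp_one (∃' (mem 3 0 ⊓ letterFml c 2 3)) a a 0 0
    (by cases c <;> decide)

theorem exists_letter_preimage (c : Bool) (a : N) :
    ∃ x, ∀ y, e y x ↔ ∃ q, IsLetter e c q y ∧ e q a := by
  simpa [Fin.snoc] using he.comp_zero (∃' (letterFml c 3 2 ⊓ mem 3 0)) a a 1 1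
    (by cases c <;> decide)

theorem exists_prod (a b : N) :
    ∃ x, ∀ y, e y x ↔ ∃ u v, (e u a ∧ e v b) ∧ ∀ z, e z y ↔ z = u ∨ z = v := by
  simpa [Fin.snoc] using he.comp_one (∃' ∃' ((mem 3 0 ⊓ mem 4 1) ⊓ upair 2 3 4)) a b 0 0 (by decide)

theorem exists_relProd (r s : N) :
    ∃ x, ∀ y, e y x ↔ ∃ a b c, (∀ z, e z y ↔ z = a ∨ z = c) ∧
      (∃ q, (∀ z, e z q ↔ z = a ∨ z = b) ∧ e q r) ∧
      ∃ q, (∀ z, e z q ↔ z = b ∨ z = c) ∧ e q s := by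
  simpa [Fin.snoc] using he.comp_one (∃' ∃' ∃' (upair 2 3 5 ⊓
    (∃' (upair 6 3 4 ⊓ mem 6 0) ⊓ ∃' (upair 6 4 5 ⊓ mem 6 1)))) r s 1 1 (by decide)

theorem exists_intersection :
    ∃ x, ∀ y, e y x ↔ ∃ a b, (∀ z, e z y ↔ z = a ∨ z = b) ∧ ∃ z, e z a ∧ e z b := by
  obtain ⟨a⟩ := he.nonempty
  simpa [Fin.snoc] using he.comp_pair (∃' (mem 4 2 ⊓ mem 4 3)) a a 0 0 (by decide)

/-- Used to raise both sides of a coded relation by one type. -/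
theorem exists_letter_pairs (c d : Bool) (r : N) :
    ∃ x, ∀ y, e y x ↔ ∃ a' b', (∀ z, e z y ↔ z = a' ∨ z = b') ∧
      ∃ a b p, (∀ z, e z p ↔ z = a ∨ z = b) ∧ e p r ∧ IsLetter e c a' a ∧ IsLetter e d b' b := by
  simpa [Fin.snoc] using he.comp_pair (∃' ∃' ∃' (upair 6 4 5 ⊓ (mem 6 0 ⊓
    (letterFml c 2 4 ⊓ letterFml d 3 5)))) r r 1 1 (by cases c <;> cases d <;> decide)

/-- Turns a set of pairs of entries into a set of codes: `{u, v} ⊆ t` says that both entries occur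
in `t`. -/
theorem exists_supersets (r : N) :
    ∃ x, ∀ y, e y x ↔ ∃ p, e p r ∧ ∀ z, e z p → e z y := by
  simpa [Fin.snoc] using he.comp_one (∃' (mem 3 0 ⊓ ∀' (mem 4 3 ⟹ mem 4 2))) r r 1 1 (by decide)

/-- The existential quantifier on codes: `y ∪ {u}` extends the code `y` by the value of one more
variable. -/
theorem exists_insert (s a : N) :
    ∃ x, ∀ y, e y x ↔ ∃ u q, e u a ∧ e q s ∧ ∀ z, e z q ↔ e z y ∨ z = u := by
  simpa [Fin.snoc] using he.comp_one (∃' ∃' (mem 3 1 ⊓ (mem 4 0 ⊓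
    ∀' (mem 5 4 ⇔ (mem 5 2 ⊔ eq 5 3))))) s a 1 0 (by decide)

/-- Fixes the parameters, coded by `t`, and leaves the last entry free. -/
theorem exists_slice (s t : N) :
    ∃ x, ∀ y, e y x ↔ ∃ q, e q s ∧ ∀ z, e z q ↔ e z t ∨ z = y := by
  simpa [Fin.snoc] using he.comp_zero (∃' (mem 3 0 ⊓ ∀' (mem 4 3 ⇔ (mem 4 1 ⊔ eq 4 2)))) s t 1 0
    (by decide)

end InvModel

/-! ### Stratified comprehension -/

namespace InvModel

variable {N : Type*} {e : N → N → Prop} (he : InvModel e)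

include he

theorem exists_letter (c : Bool) (a : N) : ∃ q, IsLetter e c q a := by
  obtain ⟨p, hp⟩ := he.pair a a
  cases c
  · exact ⟨p, fun z => by simp [hp]⟩
  · obtain ⟨q, hq⟩ := he.exists_compl p
    exact ⟨q, fun z => by simp [hq, hp]⟩

/-- The singleton of `a`, or its complement if `c` is true. -/
noncomputable def letter (c : Bool) (a : N) : N := Classical.choose (he.exists_letter c a)

theorem isLetter_letter (c : Bool) (a : N) : IsLetter e c (he.letter c a) a :=
  Classical.choose_spec (he.exists_letter c a)

theorem isLetter_iff {c : Bool} {q a : N} : IsLetter e c q a ↔ q = he.letter c a :=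
  ⟨fun h => he.ext _ _ fun z => (h z).trans (he.isLetter_letter c a z).symm,
    fun h => h ▸ he.isLetter_letter c a⟩

theorem letter_injective (c : Bool) : Function.Injective (he.letter c) := by
  intro a b hab
  have h1 := he.isLetter_letter c a a
  have h2 := he.isLetter_letter c b a
  rw [hab] at h1
  cases c <;> simpa using h1.symm.trans h2

/-- If `{a}` were the complement of `{b}`, there would be at most two sets, but `∅`, `V` and `{∅}`
are distinct. -/
theorem letter_false_ne_true (a b : N) : he.letter false a ≠ he.letter true b := by
  intro hab
  have h : ∀ z, z = a ↔ ¬ z = b := fun z =>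
    (he.isLetter_letter false a z).symm.trans (by rw [hab]; exact he.isLetter_letter true b z)
  have hall : ∀ z, z = a ∨ z = b := fun z => by
    have := h z
    tauto
  obtain ⟨o, ho⟩ := he.exists_empty
  obtain ⟨v, hv⟩ := he.exists_univ
  obtain ⟨s, hs⟩ := he.pair o o
  have h1 : o ≠ v := fun h => ho o (h ▸ hv o)
  have h2 : o ≠ s := fun h => ho o (by rw [h, hs, ← h]; exact Or.inl rfl)
  have h3 : v ≠ s := fun h => by
    have := (hs v).1 (h ▸ hv v)
    exact h1 (this.elim id id).symm
  rcases hall o with h4 | h4 <;> rcases hall v with h5 | h5 <;> rcases hall s with h6 | h6 <;>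
    simp_all

theorem letter_inj {c d : Bool} {a b : N} :
    he.letter c a = he.letter d b ↔ c = d ∧ a = b := by
  constructor
  · intro h
    cases c <;> cases d
    · exact ⟨rfl, he.letter_injective _ h⟩
    · exact absurd h (he.letter_false_ne_true _ _)
    · exact absurd h.symm (he.letter_false_ne_true _ _)
    · exact ⟨rfl, he.letter_injective _ h⟩
  · rintro ⟨rfl, rfl⟩
    rfl

/-- Iterated application of `letter`, the first letter of the word being applied last. -/
noncomputable def word : List Bool → N → N
  | [], a => a
  | c :: l, a => he.letter c (word l a)

theorem word_append (l l' : List Bool) (a : N) :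
    he.word (l ++ l') a = he.word l (he.word l' a) := by
  induction l with
  | nil => rfl
  | cons c l ih => exact congrArg _ ih

theorem exists_word_range (l : List Bool) : ∃ x, ∀ y, e y x ↔ ∃ a, y = he.word l a := by
  induction l with
  | nil =>
    obtain ⟨x, hx⟩ := he.exists_univ
    exact ⟨x, fun y => iff_of_true (hx y) ⟨y, rfl⟩⟩
  | cons c l ih =>
    obtain ⟨x, hx⟩ := ih
    obtain ⟨y, hy⟩ := he.exists_letter_image c x
    refine ⟨y, fun z => ?_⟩
    simp [hy, hx, he.isLetter_iff, word]

theorem exists_word_preimage (l : List Bool) (b : N) : ∃ x, ∀ y, e y x ↔ e (he.word l y) b := by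
  induction l generalizing b with
  | nil => exact ⟨b, fun y => Iff.rfl⟩
  | cons c l ih =>
    obtain ⟨x, hx⟩ := he.exists_letter_preimage c b
    obtain ⟨y, hy⟩ := ih x
    refine ⟨y, fun z => ?_⟩
    simp [hy, hx, he.isLetter_iff, word]

/-- The unordered pair `{a, b}`. -/
noncomputable def upr (a b : N) : N := Classical.choose (he.pair a b)

theorem mem_upr (a b z : N) : e z (he.upr a b) ↔ z = a ∨ z = b :=
  Classical.choose_spec (he.pair a b) z

theorem eq_upr_iff {a b p : N} : (∀ z, e z p ↔ z = a ∨ z = b) ↔ p = he.upr a b :=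
  ⟨fun h => he.ext _ _ fun z => (h z).trans (he.mem_upr a b z).symm, fun h => h ▸ he.mem_upr a b⟩

theorem upr_inj {a b a' b' : N} :
    he.upr a b = he.upr a' b' ↔ (a = a' ∧ b = b') ∨ (a = b' ∧ b = a') := by
  constructor
  · intro h
    have h1 := (he.mem_upr a' b' a).1 (h ▸ (he.mem_upr a b a).2 (Or.inl rfl))
    have h2 := (he.mem_upr a' b' b).1 (h ▸ (he.mem_upr a b b).2 (Or.inr rfl))
    have h3 := (he.mem_upr a b a').1 (h ▸ (he.mem_upr a' b' a').2 (Or.inl rfl))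
    have h4 := (he.mem_upr a b b').1 (h ▸ (he.mem_upr a' b' b').2 (Or.inr rfl))
    grind
  · rintro (⟨rfl, rfl⟩ | ⟨rfl, rfl⟩)
    · rfl
    · exact he.ext _ _ fun z => by rw [he.mem_upr, he.mem_upr, or_comm]

/-- Some set contains exactly those of the unordered pairs `{α a, β b}` for which `P a b`. -/
def RepPairs (α β : N → N) (P : N → N → Prop) : Prop :=
  ∃ r, ∀ a b, e (he.upr (α a) (β b)) r ↔ P a b

/-- Both words must have the same length because `exists_letter_pairs` adds a letter on both sides
at once. -/
theorem RepPairs.word {α β : N → N} {P : N → N → Prop} (h : he.RepPairs α β P) :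
    ∀ l l' : List Bool, l.length = l'.length →
      he.RepPairs (fun a => he.word l (α a)) (fun b => he.word l' (β b)) P
  | [], [], _ => h
  | c :: l, d :: l', hl => by
    obtain ⟨r, hr⟩ := RepPairs.word h l l' (by simpa using hl)
    obtain ⟨x, hx⟩ := he.exists_letter_pairs c d r
    refine ⟨x, fun a b => ?_⟩
    simp only [hx, he.eq_upr_iff, he.isLetter_iff, InvModel.word, ← hr a b]
    constructor
    · rintro ⟨_, _, h1, u, v, p, rfl, hp, rfl, rfl⟩
      rw [he.upr_inj, he.letter_inj, he.letter_inj, he.letter_inj, he.letter_inj] at h1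
      rcases h1 with ⟨⟨-, rfl⟩, -, rfl⟩ | ⟨⟨-, rfl⟩, -, rfl⟩
      · exact hp
      -- If the pairs match crosswise, then the letters `c` and `d` coincide and the underlying pair
      -- is the same one, written in the other order.
      · rwa [he.upr_inj.2 (Or.inr ⟨rfl, rfl⟩)]
    · intro hp
      exact ⟨_, _, rfl, _, _, _, rfl, hp, rfl, rfl⟩

theorem repPairs_eq : he.RepPairs (fun a => a) (fun b => b) (fun a b => a = b) := by
  obtain ⟨x, hx⟩ := he.exists_singletons
  refine ⟨x, fun a b => ?_⟩
  rw [hx]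
  constructor
  · rintro ⟨u, hu⟩
    exact ((hu a).1 ((he.mem_upr _ _ _).2 (Or.inl rfl))).trans
      ((hu b).1 ((he.mem_upr _ _ _).2 (Or.inr rfl))).symm
  · rintro rfl
    exact ⟨a, fun z => by simp [he.mem_upr]⟩

theorem repPairs_mem : he.RepPairs (he.letter false) (fun b => b) e := by
  obtain ⟨x, hx⟩ := he.exists_intersection
  refine ⟨x, fun a b => ?_⟩
  have hl : ∀ z, e z (he.letter false a) ↔ z = a := he.isLetter_letter false a
  simp only [hx, he.eq_upr_iff, he.upr_inj]
  constructor
  · rintro ⟨u, v, ⟨rfl, rfl⟩ | ⟨rfl, rfl⟩, z, h1, h2⟩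
    · exact (hl z).1 h1 ▸ h2
    · exact (hl z).1 h2 ▸ h1
  · intro h
    exact ⟨_, _, Or.inl ⟨rfl, rfl⟩, a, (hl a).2 rfl, h⟩

/-- An injection of the universe whose range is disjoint from those of the maps of different
index. -/
noncomputable def tag (i m : ℕ) : N → N :=
  he.word (List.replicate i false ++ true :: List.replicate m false)

theorem word_injective (l : List Bool) : Function.Injective (he.word l) := by
  induction l with
  | nil => exact Function.injective_id
  | cons c l ih => exact (he.letter_injective c).comp ih

/-- The index is the number of singletons to strip before reaching the complement of a singleton. -/
theorem tag_index_eq : ∀ {i j m m' : ℕ} {a b : N}, he.tag i m a = he.tag j m' b → i = j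
  | 0, 0, _, _, _, _, _ => rfl
  | 0, _ + 1, _, _, _, _, h => absurd h.symm (he.letter_false_ne_true _ _)
  | _ + 1, 0, _, _, _, _, h => absurd h (he.letter_false_ne_true _ _)
  | _ + 1, _ + 1, _, _, _, _, h => congrArg _ (tag_index_eq (he.letter_injective _ h))

/-- The `i`-th value of the assignment `x`, tagged and lifted to type `D`. -/
noncomputable def entry (D : ℕ) {n : ℕ} (s : Fin n → ℕ) (i : Fin n) : N → N :=
  he.tag i (D - s i - i - 1)

theorem entry_inj {D n : ℕ} {s : Fin n → ℕ} {i j : Fin n} {a b : N}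
    (h : he.entry D s i a = he.entry D s j b) : i = j ∧ a = b := by
  have : i = j := Fin.ext (he.tag_index_eq h)
  subst this
  exact ⟨rfl, he.word_injective _ h⟩

/-- `t` codes the assignment `x`. -/
def IsCode (D : ℕ) {n : ℕ} (s : Fin n → ℕ) (x : Fin n → N) (t : N) : Prop :=
  ∀ z, e z t ↔ ∃ i, z = he.entry D s i (x i)

theorem exists_finite {n : ℕ} (g : Fin n → N) : ∃ t, ∀ z, e z t ↔ ∃ i, z = g i := by
  induction n with
  | zero =>
    obtain ⟨t, ht⟩ := he.exists_empty
    exact ⟨t, fun z => by simp [ht]⟩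
  | succ n ih =>
    obtain ⟨t, ht⟩ := ih fun i => g i.succ
    obtain ⟨u, hu⟩ := he.exists_union (he.upr (g 0) (g 0)) t
    exact ⟨u, fun z => by simp [hu, ht, he.mem_upr, Fin.exists_fin_succ]⟩

theorem isCode_snoc {D n : ℕ} {s : Fin n → ℕ} {x : Fin n → N} {t : N} (ht : he.IsCode D s x t)
    (k : ℕ) (a q : N) :
    he.IsCode D (Fin.snoc s k : Fin (n + 1) → ℕ) (Fin.snoc x a : Fin (n + 1) → N) q ↔
      ∀ z, e z q ↔ e z t ∨ z = he.tag n (D - k - n - 1) a := by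
  refine forall_congr' fun z => ?_
  rw [Fin.exists_fin_succ']
  simp [entry, ht z]

/-- The set `r` represents the formula on codes of assignments. -/
def Represents (D : ℕ) {n : ℕ} (s : Fin n → ℕ) (φ : Fml n) (r : N) : Prop :=
  ∀ x t, he.IsCode D s x t → (e t r ↔ Sat e φ x)

/-- A code contains a pair of entries, one with tag `i` and one with tag `j`, only if they are its
own values at `i` and `j`. The set sought therefore consists of the supersets of the pairs in `r`.
-/
theorem exists_represents_atom {D n : ℕ} {s : Fin n → ℕ} {i j : Fin n} {P : N → N → Prop}
    (h : he.RepPairs (he.entry D s i) (he.entry D s j) P) :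
    ∃ r, ∀ x t, he.IsCode D s x t → (e t r ↔ P (x i) (x j)) := by
  obtain ⟨r, hr⟩ := h
  obtain ⟨A, hA⟩ := he.exists_word_range
    (List.replicate i false ++ true :: List.replicate (D - s i - i - 1) false)
  obtain ⟨B, hB⟩ := he.exists_word_range
    (List.replicate j false ++ true :: List.replicate (D - s j - j - 1) false)
  -- `r` is controlled only on pairs of entries with tags `i` and `j`; intersecting with `K`
  -- discards its other elements.
  obtain ⟨K, hK⟩ := he.exists_prod A B
  obtain ⟨r', hr'⟩ := he.exists_inter r K
  obtain ⟨u, hu⟩ := he.exists_supersets r'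
  refine ⟨u, fun x t ht => ?_⟩
  rw [hu]
  constructor
  · rintro ⟨p, hp, hpt⟩
    obtain ⟨hpr, hpK⟩ := (hr' p).1 hp
    obtain ⟨a, b, ⟨ha, hb⟩, hab⟩ := (hK p).1 hpK
    obtain ⟨a, rfl⟩ := (hA a).1 ha
    obtain ⟨b, rfl⟩ := (hB b).1 hb
    obtain ⟨k, hk⟩ := (ht _).1 (hpt _ ((hab _).2 (Or.inl rfl)))
    obtain ⟨k', hk'⟩ := (ht _).1 (hpt _ ((hab _).2 (Or.inr rfl)))
    obtain ⟨rfl, rfl⟩ := he.entry_inj (i := i) hk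
    obtain ⟨rfl, rfl⟩ := he.entry_inj (i := j) hk'
    rw [← hr]
    exact he.eq_upr_iff.1 hab ▸ hpr
  · intro hP
    refine ⟨he.upr (he.entry D s i (x i)) (he.entry D s j (x j)), (hr' _).2 ⟨(hr _ _).2 hP, ?_⟩, ?_⟩
    · exact (hK _).2 ⟨_, _, ⟨(hA _).2 ⟨_, rfl⟩, (hB _).2 ⟨_, rfl⟩⟩, he.mem_upr _ _⟩
    · intro z hz
      rw [ht]
      rcases (he.mem_upr _ _ _).1 hz with rfl | rfl
      · exact ⟨_, rfl⟩
      · exact ⟨_, rfl⟩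

/-- Every sufficiently large `D` is allowed, so that the two sides of an implication can share one
coding. -/
theorem exists_represents {n : ℕ} (φ : Fml n) (s : Fin n → ℕ) (hφ : StratifiedBy s φ) :
    ∃ D₀, ∀ D, D₀ ≤ D → ∃ r, he.Represents D s φ r := by
  induction φ with
  | falsum =>
    obtain ⟨r, hr⟩ := he.exists_empty
    exact ⟨0, fun D _ => ⟨r, fun x t _ => iff_of_false (hr t) id⟩⟩
  | equal t u =>
    have h : s (idx t) = s (idx u) := hφ
    -- From this bound on, the truncated subtractions in `entry` are exact, and the word for
    -- variable `i` has length `D - s i`.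
    refine ⟨s (idx t) + idx t + idx u + 1, fun D hD => ?_⟩
    obtain ⟨r, hr⟩ := he.exists_represents_atom (s := s) (D := D) (i := idx t) (j := idx u)
      (RepPairs.word he he.repPairs_eq _ _ (by simp; omega))
    exact ⟨r, fun x c hc => (hr x c hc).trans (sat_equal t u).symm⟩
  | rel R ts =>
    cases R
    have h : s (idx (ts 1)) = s (idx (ts 0)) + 1 := hφ
    refine ⟨s (idx (ts 1)) + idx (ts 0) + idx (ts 1) + 1, fun D hD => ?_⟩
    have hrep : he.RepPairs (he.entry D s (idx (ts 0))) (he.entry D s (idx (ts 1))) e := by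
      -- The left variable has type one lower, so its word is one letter longer. The innermost
      -- letter, a singleton, is split off to match `repPairs_mem`, and the remaining words have
      -- equal length.
      have key : ∀ a, he.entry D s (idx (ts 0)) a = he.word
          (List.replicate (idx (ts 0)) false ++ true ::
            List.replicate (D - s (idx (ts 1)) - idx (ts 0) - 1) false) (he.letter false a) := by
        intro a
        have hm : D - s (idx (ts 0)) - idx (ts 0) - 1 =
          D - s (idx (ts 1)) - idx (ts 0) - 1 + 1 := by omega
        have h1 : he.letter false a = he.word [false] a := rfl
        rw [h1, ← he.word_append, entry, tag, hm, List.replicate_succ', List.append_assoc,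
          List.cons_append]
      rw [funext key]
      exact RepPairs.word he he.repPairs_mem _ _ (by simp; omega)
    obtain ⟨r, hr⟩ := he.exists_represents_atom hrep
    exact ⟨r, fun x c hc => (hr x c hc).trans (sat_rel ts).symm⟩
  | imp φ ψ ihφ ihψ =>
    obtain ⟨D₁, h₁⟩ := ihφ s hφ.1
    obtain ⟨D₂, h₂⟩ := ihψ s hφ.2
    refine ⟨max D₁ D₂, fun D hD => ?_⟩
    obtain ⟨r₁, hr₁⟩ := h₁ D ((le_max_left _ _).trans hD)
    obtain ⟨r₂, hr₂⟩ := h₂ D ((le_max_right _ _).trans hD)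
    obtain ⟨r₃, hr₃⟩ := he.exists_compl r₂
    obtain ⟨r, hr⟩ := he.exists_sheffer r₁ r₃
    refine ⟨r, fun x c hc => ?_⟩
    rw [hr, hr₃, hr₁ x c hc, hr₂ x c hc, sat_imp]
    tauto
  | @all n φ ih =>
    obtain ⟨k, hk⟩ := hφ
    obtain ⟨D₀, hD₀⟩ := ih _ hk
    refine ⟨D₀, fun D hD => ?_⟩
    obtain ⟨r₁, hr₁⟩ := hD₀ D hD
    -- The universal quantifier is treated as `¬∃¬`, and `A` restricts the added element to entries
    -- with tag `n`.
    obtain ⟨r₂, hr₂⟩ := he.exists_compl r₁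
    obtain ⟨A, hA⟩ := he.exists_word_range
      (List.replicate n false ++ true :: List.replicate (D - k - n - 1) false)
    obtain ⟨r₃, hr₃⟩ := he.exists_insert r₂ A
    obtain ⟨r, hr⟩ := he.exists_compl r₃
    refine ⟨r, fun x c hc => ?_⟩
    rw [hr, hr₃, sat_all]
    constructor
    · intro h a
      by_contra hna
      obtain ⟨q, hq⟩ := he.exists_union c (he.upr (he.tag n (D - k - n - 1) a)
        (he.tag n (D - k - n - 1) a))
      simp only [he.mem_upr, or_self] at hq
      exact h ⟨_, q, (hA _).2 ⟨a, rfl⟩, (hr₂ q).2 fun hq' =>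
        hna ((hr₁ _ q ((he.isCode_snoc hc k a q).2 hq)).1 hq'), hq⟩
    · rintro h ⟨u, q, hu, hq, hz⟩
      obtain ⟨a, rfl⟩ := (hA u).1 hu
      exact (hr₂ q).1 hq ((hr₁ _ q ((he.isCode_snoc hc k a q).2 hz)).2 (h a))

/-- With the parameters coded by `t`, the slice of the representing set at `t` collects the
admissible last entries, and the preimage under the tagging word recovers the values `y` themselves.
-/
theorem stratified_comprehension {n : ℕ} (φ : Fml (n + 1)) (hφ : Stratified φ) (xs : Fin n → N) :
    ∃ x, ∀ y, e y x ↔ Sat e φ (Fin.snoc xs y) := by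
  obtain ⟨s, hs⟩ := hφ
  rw [← Fin.snoc_init_self s] at hs
  obtain ⟨D, hD⟩ := he.exists_represents φ _ hs
  obtain ⟨r, hr⟩ := hD D le_rfl
  obtain ⟨t, ht⟩ := he.exists_finite fun i => he.entry D (Fin.init s) i (xs i)
  obtain ⟨b, hb⟩ := he.exists_slice r t
  obtain ⟨x, hx⟩ := he.exists_word_preimage
    (List.replicate n false ++ true :: List.replicate (D - s (Fin.last n) - n - 1) false) b
  refine ⟨x, fun y => ?_⟩
  rw [hx, hb]
  constructor
  · rintro ⟨q, hq, hqt⟩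
    exact (hr _ q ((he.isCode_snoc ht _ y q).2 hqt)).1 hq
  · intro hy
    obtain ⟨q, hq⟩ := he.exists_union t (he.upr (he.tag n (D - s (Fin.last n) - n - 1) y)
      (he.tag n (D - s (Fin.last n) - n - 1) y))
    simp only [he.mem_upr, or_self] at hq
    exact ⟨q, (hr _ q ((he.isCode_snoc ht _ y q).2 hq)).2 hy, hq⟩

theorem sat_of_NF (σ : L.Sentence) (hσ : NF ⊨ᵇ σ) : Sat e σ default := by
  let _ := str e
  have := he.nonempty
  have : N ⊨ NF := by
    rw [Theory.model_iff]
    rintro _ (_ | ⟨φ, hφ⟩)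
    · exact sat_extensionality.2 he.ext
    · exact (sat_setComprehension φ).2 (he.stratified_comprehension φ hφ)
  exact hσ.realize_sentence N

end InvModel

/-! ### Models of the class theory -/

section Model

variable {M : Type*} {R : M → M → Prop}

theorem eq_str [inst : L.Structure M] :
    inst = str fun a b : M => @Structure.RelMap L M inst 2 MemRel.mem ![a, b] := by
  ext n f xs
  · exact Empty.elim f
  · cases f
    refine Eq.to_iff (congrArg _ ?_)
    funext i
    fin_cases i <;> rfl

theorem realize_iff_sat [inst : L.Structure M] (σ : L.Sentence) :
    M ⊨ σ ↔ Sat (fun a b : M => @Structure.RelMap L M inst 2 MemRel.mem ![a, b]) σ default := by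
  rw [Sat, ← eq_str]
  rfl

theorem models_of_invModel (σ : L.Sentence)
    (h : ∀ (M : Type) (R : M → M → Prop), InvModel (setRel R) → Sat R σ default) :
    classTheory ⊨ᵇ σ := by
  rw [Theory.models_sentence_iff]
  intro M
  have hM := M.is_model
  rw [Theory.model_iff] at hM
  exact (realize_iff_sat σ).2 (h M _ (invModel_of_sat fun τ hτ => (realize_iff_sat τ).1 (hM τ hτ)))

/-! ### Transfer of the closure properties to the class language -/

theorem uPair_iff (p a b : {x // ∃ k, R x k}) :
    UPair R p a b ↔ ∀ z, setRel R z p ↔ z = a ∨ z = b := by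
  simp only [Subtype.ext_iff, Subtype.forall]
  constructor
  · exact fun h z _ => h.2.2 z
  · refine fun h => ⟨a.2, b.2, fun z => ⟨fun hz => (h z ⟨_, hz⟩).1 hz, ?_⟩⟩
    rintro (rfl | rfl)
    · exact (h _ a.2).2 (Or.inl rfl)
    · exact (h _ b.2).2 (Or.inr rfl)

/-- A collection of sets given by a set is a set in the sense of the class theory. -/
theorem exists_set {P : {x // ∃ k, R x k} → Prop} {Q : M → Prop}
    (h : ∃ x, ∀ y, setRel R y x ↔ P y) (hPQ : ∀ y, P y ↔ Q y) :
    ∃ x, (∃ k, R x k) ∧ ∀ y, R y x ↔ (∃ k, R y k) ∧ Q y := by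
  obtain ⟨x, hx⟩ := h
  refine ⟨x, x.2, fun y => ⟨fun hy => ⟨⟨_, hy⟩, ?_⟩, fun hy => ?_⟩⟩
  · exact (hPQ ⟨y, _, hy⟩).1 ((hx _).1 hy)
  · exact (hx ⟨y, hy.1⟩).2 ((hPQ _).2 hy.2)

theorem models_shefferStroke : classTheory ⊨ᵇ shefferStroke := by
  refine models_of_invModel _ fun M R he => ?_
  have h : ∀ a b, (∃ k, R a k) ∧ (∃ k, R b k) → ∃ x, (∃ k, R x k) ∧
      ∀ y, R y x ↔ (∃ k, R y k) ∧ ¬ (R y a ∧ R y b) := fun a b h =>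
    exists_set (he.exists_sheffer ⟨a, h.1⟩ ⟨b, h.2⟩) fun _ => Iff.rfl
  simpa [shefferStroke, Fin.snoc] using h

theorem models_singletons : classTheory ⊨ᵇ singletons := by
  refine models_of_invModel _ fun M R he => ?_
  have h : ∀ a, (∃ k, R a k) → ∃ x, (∃ k, R x k) ∧ ∀ y, R y x ↔ (∃ k, R y k) ∧ y = a :=
    fun a h => exists_set (he.pair ⟨a, h⟩ ⟨a, h⟩) fun y => by rw [or_self, Subtype.ext_iff]
  simpa [singletons, Fin.snoc] using h

theorem models_setUnion : classTheory ⊨ᵇ setUnion := by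
  refine models_of_invModel _ fun M R he => ?_
  have h : ∀ a, (∃ k, R a k) → ∃ x, (∃ k, R x k) ∧
      ∀ y, R y x ↔ (∃ k, R y k) ∧ ∃ z, ((∃ k, R z k) ∧ R z a) ∧ R y z := fun a h =>
    exists_set (he.exists_sUnion ⟨a, h⟩) fun y => by simp [setRel, and_assoc, and_left_comm]
  simpa [setUnion, Fin.snoc] using h

theorem models_unorderedRelativeProducts : classTheory ⊨ᵇ unorderedRelativeProducts := by
  refine models_of_invModel _ fun M R he => ?_
  have h : ∀ r s, (∃ k, R r k) ∧ (∃ k, R s k) → ∃ x, (∃ k, R x k) ∧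
      ∀ y, R y x ↔ (∃ k, R y k) ∧ ∃ a b c, (UPair R y a c ∧
        (∃ q, UPair R q a b ∧ R q r)) ∧ ∃ q, UPair R q b c ∧ R q s := fun r s h =>
    exists_set (he.exists_relProd ⟨r, h.1⟩ ⟨s, h.2⟩) fun y => by
      simp only [← uPair_iff]
      constructor
      · rintro ⟨a, b, c, h1, ⟨q, h2⟩, q', h3⟩
        exact ⟨a, b, c, ⟨h1, q, h2⟩, q', h3⟩
      · rintro ⟨a, b, c, ⟨h1, q, h2, h2'⟩, q', h3, h3'⟩
        exact ⟨⟨a, h1.1⟩, ⟨b, h3.1⟩, ⟨c, h1.2.1⟩, h1, ⟨⟨q, _, h2'⟩, h2, h2'⟩, ⟨q', _, h3'⟩, h3, h3'⟩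
  simpa [unorderedRelativeProducts, Fin.snoc, sat_isUPair, UPair] using h

theorem models_unorderedIntersection : classTheory ⊨ᵇ unorderedIntersection := by
  refine models_of_invModel _ fun M R he => ?_
  have h : ∃ x, (∃ k, R x k) ∧
      ∀ y, R y x ↔ (∃ k, R y k) ∧ ∃ a b, UPair R y a b ∧
        ∃ z, ((∃ k, R z k) ∧ R z a) ∧ R z b :=
    exists_set he.exists_intersection fun y => by
      simp only [← uPair_iff]
      constructor
      · rintro ⟨a, b, h, z, h1, h2⟩
        exact ⟨a, b, h, z, ⟨z.2, h1⟩, h2⟩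
      · rintro ⟨a, b, h, z, ⟨hz, h1⟩, h2⟩
        exact ⟨⟨a, h.1⟩, ⟨b, h.2.1⟩, h, ⟨z, hz⟩, h1, h2⟩
  simpa [unorderedIntersection, Fin.snoc, sat_isUPair, UPair] using h

theorem interpretsOnSets_NF : InterpretsOnSets classTheory NF := by
  refine ⟨models_of_invModel _ fun M R he => ?_, fun σ hσ => models_of_invModel _ fun M R he => ?_⟩
  · obtain ⟨x⟩ := he.nonempty
    simpa using ⟨(x : M), x.2⟩
  · have h := (sat_relV (R := R) (p := fun x => ∃ k, R x k) (fun _ => Iff.rfl) default).2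
      (he.sat_of_NF σ hσ)
    rwa [Subsingleton.elim (fun i : Fin 0 => ((default : Fin 0 → {x // ∃ k, R x k}) i : M))
      default] at h

end Model

end InvClass

theorem mainTheorem1 :
    ((InvClass.classTheory ⊨ᵇ InvClass.shefferStroke) ∧
      (InvClass.classTheory ⊨ᵇ InvClass.singletons) ∧
      (InvClass.classTheory ⊨ᵇ InvClass.setUnion) ∧
      (InvClass.classTheory ⊨ᵇ InvClass.unorderedRelativeProducts) ∧
      (InvClass.classTheory ⊨ᵇ InvClass.unorderedIntersection)) ∧
    InvClass.InterpretsOnSets InvClass.classTheory InvClass.NF :=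
  ⟨⟨InvClass.models_shefferStroke, InvClass.models_singletons, InvClass.models_setUnion,
    InvClass.models_unorderedRelativeProducts, InvClass.models_unorderedIntersection⟩,
    InvClass.interpretsOnSets_NF⟩
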